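/- Let $L\subset\mathbb C$ be a lattice in the plane (a discrete subgroup that spans $\mathbb C$ over $\mathbb R$). A vector $v\in L$ is called primitive if $v=nw$ with $n\in\mathbb Z$ and $w\in L$ only for $n=\pm1$; let $L_{prim}(T)$ be the finite set of primitive vectors $v$ of $L$ with $|v|\le T$. Every primitive $v\in L$ can be completed to a basis $\{v,v'\}$ of $L$ that is positively oriented, i.e. $\operatorname{Im}(v'/v)>0$, and among these completions there is a vector $v'$ of minimal length $|v'|$. Set $\rho(v)=+|v'|/|v|$ if the angle between $v$ and $v'$ is acute, and $\rho(v)=-|v'|/|v|$ otherwise, where $v'$ is such a shortest completion (if there are several of them for some $v$, any choice is allowed). Then $\rho(v)$ becomes uniformly distributed modulo one as $v$ ranges over the primitive vectors of $L$: for all $0\le a<b\le1$, $$\frac{\#\{v\in L_{prim}(T): \{\rho(v)\}\in[a,b)\}}{\#L_{prim}(T)}\longrightarrow b-a\qquad(T\to\infty),$$ where $\{\cdot\}$ denotes the fractional part. Moreover, for every interval $[\alpha,\beta]\subset(-\tfrac12,\tfrac12]$, $$\frac{\#\{v\in L_{prim}(T): \alpha<\rho(v)<\beta\}}{\#L_{prim}(T)}\longrightarrow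 \beta-\alpha\qquad(T\to\infty).$$ -/

import Mathlib

open Filter Topology

/-- `v` is a primitive vector of the lattice `L`: it lies in `L` and is an integer multiple `n • w`
of a vector `w` of `L` only for `n = 1` or `n = -1`. (The zero vector is `2 • 0`, so it is not
primitive.) -/
def IsPrimitiveVector (L : Submodule ℤ ℂ) (v : ℂ) : Prop :=
  v ∈ L ∧ ∀ w ∈ L, ∀ n : ℤ, v = n • w → n = 1 ∨ n = -1

/-- The set of primitive vectors of `L` of norm at most `T`. -/
def primitiveVectors (L : Submodule ℤ ℂ) (T : ℝ) : Set ℂ :=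
  {v | IsPrimitiveVector L v ∧ ‖v‖ ≤ T}

/-- `{v, v'}` is a positively oriented basis of `L`: the two vectors are linearly independent
over `ℤ`, they span `L` over `ℤ`, and `Im (v' / v) > 0`. -/
def IsPositiveBasis (L : Submodule ℤ ℂ) (v v' : ℂ) : Prop :=
  LinearIndependent ℤ ![v, v'] ∧ Submodule.span ℤ {v, v'} = L ∧ 0 < (v' / v).im

/-- `v'` is a shortest vector among those that complete `v` to a positively oriented basis
of `L`. -/
def IsMinimalCompletion (L : Submodule ℤ ℂ) (v v' : ℂ) : Prop :=
  IsPositiveBasis L v v' ∧ ∀ w, IsPositiveBasis L v w → ‖v'‖ ≤ ‖w‖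

open Classical in
/-- The ratio `|v'| / |v|` with sign `+` if the angle between `v` and `v'` is acute, and `-`
otherwise. -/
noncomputable def signedRatio (v v' : ℂ) : ℝ :=
  if InnerProductGeometry.angle v v' < Real.pi / 2 then ‖v'‖ / ‖v‖ else -(‖v'‖ / ‖v‖)

/-- `r` is a value of the signed ratio at `v`: it is the signed ratio of `v` and a minimal
completion `v'`. (For the finitely many `v` with two minimal completions there are two such
values.) -/
def IsSignedRatio (L : Submodule ℤ ℂ) (v : ℂ) (r : ℝ) : Prop :=
  ∃ v', IsMinimalCompletion L v v' ∧ r = signedRatio v v'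

/-- The numbers `f x`, with `x` ranging over the finite sets `A T`, become uniformly distributed
modulo one as `T → ∞`: for every interval `[a, b) ⊆ [0, 1)`, the proportion of `x ∈ A T` for which
the fractional part of `f x` lies in `[a, b)` tends to `b - a`. -/
def UniformlyDistributedModOne {X : Type*} (A : ℝ → Set X) (f : X → ℝ) : Prop :=
  (∀ T, (A T).Finite) ∧
  ∀ a b : ℝ, 0 ≤ a → a < b → b ≤ 1 →
    Tendsto (fun T : ℝ =>
        ({x ∈ A T | Int.fract (f x) ∈ Set.Ico a b}.ncard : ℝ) / ((A T).ncard : ℝ))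
      atTop (𝓝 (b - a))

/-! Write a positively oriented completion of `v` as `v'`. The completions of `v` are the `v' + n •
v`, so Re(v'/v) is determined modulo one, and Im(v'/v) = A/|v|² with A the covolume. A shortest
completion has |Re(v'/v)| ≤ 1/2, and ρ(v) differs from Re(v'/v) by at most A/|v|². Hence it suffices
to equidistribute Re(v'/v) modulo one.

The crucial count concerns a short arc (p/q, p/q + 1/(kq²)) to the right of a fraction. Put w = q v'
- p v. Then w is primitive, and Re(v'/v) lies in the arc as soon as Re(v/w) > qk. Conversely, a
primitive w arises from exactly one v with Re(v/w) in each window (q(K-1), qK], and then |v| is at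
most about qK|w|. If there are ~cT² primitive vectors of norm at most T, summing over K > k gives at
least about cT²/(q²(k+1)) vectors v (`exists_sum_ncard_le_ncard_vectorsWithRatioIn`,
`eventually_mul_sq_le_ncard_vectorsWithRatioIn`). This is the expected share up to the factor
k/(k+1), which tends to 1.

Dirichlet approximation makes these arcs a Vitali family, so finitely many disjoint ones nearly
exhaust any interval (`exists_finset_disjoint_arcs`). This yields the lower bound β - α for the
density of every interval. No upper bound needs proof: lower bounds for disjoint intervals of total
length one force equality (`HasLowerDensity.tendsto`). -/

/-! ### Oriented bases and primitive vectors -/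

/-- The signed area of the parallelogram spanned by `v` and `w`. -/
def cross (v w : ℂ) : ℝ := v.re * w.im - v.im * w.re

lemma im_div_eq_cross (v w : ℂ) : (w / v).im = cross v w / ‖v‖ ^ 2 := by
  rw [Complex.div_im, Complex.sq_norm, cross]; ring

lemma ne_zero_of_cross_pos {v w : ℂ} (h : 0 < cross v w) : v ≠ 0 := by
  rintro rfl; simp [cross] at h

lemma cross_zsmul_add_zsmul (a b c d : ℤ) (v w : ℂ) :
    cross (a • v + c • w) (b • v + d • w) = ((a * d - b * c : ℤ) : ℝ) * cross v w := by
  simp [cross]; ring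

lemma cross_swap (v w : ℂ) : cross w v = -cross v w := by
  simp [cross]; ring

section PositiveBasis

variable {L : Submodule ℤ ℂ} {v w e₁ e₂ : ℂ}

lemma IsPositiveBasis.mem_left (h : IsPositiveBasis L v w) : v ∈ L :=
  h.2.1 ▸ Submodule.subset_span (by simp)

lemma IsPositiveBasis.mem_right (h : IsPositiveBasis L v w) : w ∈ L :=
  h.2.1 ▸ Submodule.subset_span (by simp)

lemma IsPositiveBasis.cross_pos (h : IsPositiveBasis L v w) : 0 < cross v w := by
  have h0 := h.2.2
  rw [im_div_eq_cross] at h0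
  by_contra hn
  exact absurd h0 (not_lt.2 (div_nonpos_of_nonpos_of_nonneg (not_lt.1 hn) (by positivity)))

lemma IsPositiveBasis.exists_coords (h : IsPositiveBasis L e₁ e₂) (hv : v ∈ L) :
    ∃ a b : ℤ, v = a • e₁ + b • e₂ := by
  rw [← h.2.1, Submodule.mem_span_pair] at hv
  obtain ⟨a, b, hab⟩ := hv
  exact ⟨a, b, hab.symm⟩

lemma coords_eq_zero_of_cross_ne_zero (h : cross e₁ e₂ ≠ 0) {a b : ℤ}
    (hab : a • e₁ + b • e₂ = 0) : a = 0 ∧ b = 0 := by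
  have h1 : (a : ℝ) * cross e₁ e₂ = 0 := by
    have : (a : ℝ) * cross e₁ e₂ = cross (a • e₁ + b • e₂) e₂ := by simp [cross]; ring
    rw [this, hab]; simp [cross]
  have h2 : (b : ℝ) * cross e₁ e₂ = 0 := by
    have : (b : ℝ) * cross e₁ e₂ = cross e₁ (a • e₁ + b • e₂) := by simp [cross]; ring
    rw [this, hab]; simp [cross]
  simpa [h] using And.intro h1 h2

lemma coords_injective_of_cross_ne_zero (h : cross e₁ e₂ ≠ 0) {a b a' b' : ℤ}
    (hab : a • e₁ + b • e₂ = a' • e₁ + b' • e₂) : a = a' ∧ b = b' := by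
  have := coords_eq_zero_of_cross_ne_zero h (a := a - a') (b := b - b') (by
    rw [sub_smul, sub_smul]; linear_combination hab)
  omega

lemma isPositiveBasis_of_span_le (hv : v ∈ L) (hw : w ∈ L) (h : 0 < cross v w)
    (hspan : ∀ x ∈ L, ∃ a b : ℤ, x = a • v + b • w) : IsPositiveBasis L v w := by
  refine ⟨?_, le_antisymm ?_ ?_, ?_⟩
  · rw [LinearIndependent.pair_iff]
    intro a b hab
    exact coords_eq_zero_of_cross_ne_zero h.ne' hab
  · rw [Submodule.span_le]
    rintro x (rfl | rfl) <;> assumption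
  · intro x hx
    obtain ⟨a, b, rfl⟩ := hspan x hx
    exact Submodule.mem_span_pair.2 ⟨a, b, rfl⟩
  · rw [im_div_eq_cross]
    have := norm_pos_iff.2 (ne_zero_of_cross_pos h)
    positivity

/-- The two change-of-basis determinants are positive integers with product one. Conversely,
determinant one makes the coordinate change invertible over the integers by Cramer's rule. -/
lemma IsPositiveBasis.iff_cross_eq (h : IsPositiveBasis L e₁ e₂) :
    IsPositiveBasis L v w ↔ v ∈ L ∧ w ∈ L ∧ cross v w = cross e₁ e₂ := by
  constructor
  · intro h'
    refine ⟨h'.mem_left, h'.mem_right, ?_⟩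
    obtain ⟨a, c, hv⟩ := h.exists_coords h'.mem_left
    obtain ⟨b, d, hw⟩ := h.exists_coords h'.mem_right
    obtain ⟨a', c', he₁⟩ := h'.exists_coords h.mem_left
    obtain ⟨b', d', he₂⟩ := h'.exists_coords h.mem_right
    have h1 : cross v w = ((a * d - b * c : ℤ) : ℝ) * cross e₁ e₂ := by
      rw [← cross_zsmul_add_zsmul, ← hv, ← hw]
    have h2 : cross e₁ e₂ = ((a' * d' - b' * c' : ℤ) : ℝ) * cross v w := by
      rw [← cross_zsmul_add_zsmul, ← he₁, ← he₂]
    have p1 := h.cross_pos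
    have p2 := h'.cross_pos
    generalize a * d - b * c = m at *
    generalize a' * d' - b' * c' = n at *
    have hm : 0 < m := by
      have : 0 < (m : ℝ) := by
        by_contra hn; nlinarith
      exact_mod_cast this
    have hn : 0 < n := by
      have : 0 < (n : ℝ) := by
        by_contra hn; nlinarith
      exact_mod_cast this
    have hm' : (1 : ℝ) ≤ m := by exact_mod_cast hm
    have hn' : (1 : ℝ) ≤ n := by exact_mod_cast hn
    nlinarith
  · rintro ⟨hv, hw, hc⟩
    obtain ⟨a, c, rfl⟩ := h.exists_coords hv
    obtain ⟨b, d, rfl⟩ := h.exists_coords hw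
    have hdet : a * d - b * c = 1 := by
      rw [cross_zsmul_add_zsmul] at hc
      have := mul_right_cancel₀ h.cross_pos.ne' (hc.trans (one_mul _).symm)
      exact_mod_cast this
    refine isPositiveBasis_of_span_le hv hw (hc ▸ h.cross_pos) ?_
    intro x hx
    obtain ⟨m, n, rfl⟩ := h.exists_coords hx
    refine ⟨m * d - n * b, n * a - m * c, ?_⟩
    have hdet' : (a * d - b * c : ℂ) = 1 := by exact_mod_cast hdet
    simp only [zsmul_eq_mul]
    push_cast
    linear_combination (-(m : ℂ) * e₁ - n * e₂) * hdet'

lemma IsPositiveBasis.add_zsmul (h : IsPositiveBasis L v w) (n : ℤ) :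
    IsPositiveBasis L v (w + n • v) := by
  refine h.iff_cross_eq.2 ⟨h.mem_left, L.add_mem h.mem_right (L.smul_mem n h.mem_left), ?_⟩
  simp [cross]; ring

lemma IsPositiveBasis.exists_eq_add_zsmul {w' : ℂ} (h : IsPositiveBasis L v w)
    (h' : IsPositiveBasis L v w') : ∃ n : ℤ, w' = w + n • v := by
  obtain ⟨a, b, hw'⟩ := h.exists_coords h'.mem_right
  have hb : (b : ℝ) * cross v w = cross v w := by
    conv_rhs => rw [← (h.iff_cross_eq.1 h').2.2, hw']
    simp [cross]; ring
  have hb1 : b = 1 := by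
    exact_mod_cast mul_right_cancel₀ h.cross_pos.ne' (hb.trans (one_mul _).symm)
  exact ⟨a, by rw [hw', hb1, one_smul, add_comm]⟩

lemma IsPositiveBasis.isPrimitiveVector (h : IsPositiveBasis L v w) :
    IsPrimitiveVector L v := by
  refine ⟨h.mem_left, fun x hx n hn => ?_⟩
  obtain ⟨a, b, hab⟩ := h.exists_coords hx
  have h1 : (1 : ℤ) • v + (0 : ℤ) • w = (n * a) • v + (n * b) • w := by
    rw [one_smul, zero_smul, add_zero, mul_smul, mul_smul, ← smul_add, ← hab, ← hn]
  exact Int.eq_one_or_neg_one_of_mul_eq_one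
    (coords_injective_of_cross_ne_zero h.cross_pos.ne' h1).1.symm

lemma IsPositiveBasis.isPrimitiveVector_iff (h : IsPositiveBasis L e₁ e₂) {a b : ℤ} :
    IsPrimitiveVector L (a • e₁ + b • e₂) ↔ Int.gcd a b = 1 := by
  constructor
  · rintro ⟨-, hp⟩
    obtain ⟨a', ha⟩ := Int.gcd_dvd_left a b
    obtain ⟨b', hb⟩ := Int.gcd_dvd_right a b
    have := hp (a' • e₁ + b' • e₂)
      (L.add_mem (L.smul_mem _ h.mem_left) (L.smul_mem _ h.mem_right)) (Int.gcd a b) (by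
        rw [smul_add, ← mul_smul, ← mul_smul, ← ha, ← hb])
    omega
  · intro hg
    obtain ⟨x, y, hxy⟩ : ∃ x y : ℤ, a * x + b * y = 1 := by
      have := Int.gcd_eq_gcd_ab a b
      exact ⟨_, _, by rw [← this, hg]; rfl⟩
    have hm : ∀ m n : ℤ, m • e₁ + n • e₂ ∈ L := fun m n =>
      L.add_mem (L.smul_mem _ h.mem_left) (L.smul_mem _ h.mem_right)
    refine IsPositiveBasis.isPrimitiveVector (w := (-y) • e₁ + x • e₂)
      (h.iff_cross_eq.2 ⟨hm _ _, hm _ _, ?_⟩)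
    rw [cross_zsmul_add_zsmul, show a * x - -y * b = 1 by linarith]
    simp

lemma IsPositiveBasis.exists_completion (h : IsPositiveBasis L e₁ e₂)
    (hv : IsPrimitiveVector L v) : ∃ w, IsPositiveBasis L v w := by
  have hm : ∀ m n : ℤ, m • e₁ + n • e₂ ∈ L := fun m n =>
    L.add_mem (L.smul_mem _ h.mem_left) (L.smul_mem _ h.mem_right)
  obtain ⟨a, b, rfl⟩ := h.exists_coords hv.1
  have hg := h.isPrimitiveVector_iff.1 hv
  obtain ⟨x, y, hxy⟩ : ∃ x y : ℤ, a * x + b * y = 1 := by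
    have := Int.gcd_eq_gcd_ab a b
    exact ⟨_, _, by rw [← this, hg]; rfl⟩
  refine ⟨(-y) • e₁ + x • e₂, h.iff_cross_eq.2 ⟨hm _ _, hm _ _, ?_⟩⟩
  rw [cross_zsmul_add_zsmul, show a * x - -y * b = 1 by linarith]
  simp

end PositiveBasis

/-! ### Discreteness, existence of bases and of minimal completions -/

lemma finite_setOf_mem_norm_le (L : Submodule ℤ ℂ) [DiscreteTopology L] (T : ℝ) :
    {v : ℂ | v ∈ L ∧ ‖v‖ ≤ T}.Finite := by
  have hcl : IsClosed (L : Set ℂ) :=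
    AddSubgroup.isClosed_of_discrete (H := L.toAddSubgroup)
  refine (Metric.finite_isBounded_inter_isClosed DiscreteTopology.isDiscrete
    (Metric.isBounded_closedBall (x := (0 : ℂ)) (r := T)) hcl).subset ?_
  rintro v ⟨hv, hT⟩
  exact ⟨by simpa using hT, hv⟩

lemma finite_primitiveVectors (L : Submodule ℤ ℂ) [DiscreteTopology L] (T : ℝ) :
    (primitiveVectors L T).Finite :=
  (finite_setOf_mem_norm_le L T).subset fun _ hv => ⟨hv.1.1, hv.2⟩

section Lattice

variable (L : Submodule ℤ ℂ) [DiscreteTopology L] [IsZLattice ℝ L]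

lemma exists_isPositiveBasis : ∃ e₁ e₂, IsPositiveBasis L e₁ e₂ := by
  have hfr : Module.finrank ℤ L = 2 := by
    rw [ZLattice.rank ℝ L, Complex.finrank_real_complex]
  let b := Module.finBasisOfFinrankEq ℤ L hfr
  have hspan : ∀ x ∈ L, ∃ m n : ℤ, x = m • (b 0 : ℂ) + n • (b 1 : ℂ) := by
    intro x hx
    refine ⟨b.repr ⟨x, hx⟩ 0, b.repr ⟨x, hx⟩ 1, ?_⟩
    have := congrArg Subtype.val (b.sum_repr ⟨x, hx⟩)
    rw [Fin.sum_univ_two] at this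
    exact this.symm
  have hc : cross (b 0) (b 1) ≠ 0 := by
    intro hc
    have hli : LinearIndependent ℝ ![(b 0 : ℂ), (b 1 : ℂ)] := by
      have h : ⇑(b.ofZLatticeBasis ℝ L) = ![(b 0 : ℂ), (b 1 : ℂ)] := by
        ext i : 1
        fin_cases i <;> simp
      exact h ▸ (b.ofZLatticeBasis ℝ L).linearIndependent
    rw [LinearIndependent.pair_iff] at hli
    unfold cross at hc
    -- With zero area, the real parts and then the imaginary parts serve as coefficients of a linear
    -- relation; independence then kills both coordinates of `b 0`.
    have h1 := hli (b 1 : ℂ).re (-(b 0 : ℂ).re) (by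
      apply Complex.ext <;> simp <;> linarith)
    have h2 := hli (b 1 : ℂ).im (-(b 0 : ℂ).im) (by
      apply Complex.ext <;> simp <;> linarith)
    have h3 : (b 0 : ℂ) = 0 := Complex.ext (by simpa using h1.2) (by simpa using h2.2)
    exact b.ne_zero 0 (Subtype.ext h3)
  rcases lt_or_gt_of_ne hc with hneg | hpos
  · refine ⟨b 1, b 0, isPositiveBasis_of_span_le (b 1).2 (b 0).2 ?_ ?_⟩
    · rw [cross_swap]; linarith
    · intro x hx
      obtain ⟨m, n, h⟩ := hspan x hx
      exact ⟨n, m, by rw [h, add_comm]⟩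
  · exact ⟨b 0, b 1, isPositiveBasis_of_span_le (b 0).2 (b 1).2 hpos hspan⟩

variable {L} in
lemma exists_isMinimalCompletion {v : ℂ} (hv : IsPrimitiveVector L v) :
    ∃ w, IsMinimalCompletion L v w := by
  obtain ⟨e₁, e₂, he⟩ := exists_isPositiveBasis L
  obtain ⟨w₀, hw₀⟩ := he.exists_completion hv
  have hfin : {w | IsPositiveBasis L v w ∧ ‖w‖ ≤ ‖w₀‖}.Finite :=
    (finite_setOf_mem_norm_le L ‖w₀‖).subset fun w hw => ⟨hw.1.mem_right, hw.2⟩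
  obtain ⟨w, hw, hmin⟩ := hfin.exists_minimalFor (fun w => ‖w‖) _ ⟨w₀, hw₀, le_rfl⟩
  refine ⟨w, hw.1, fun x hx => ?_⟩
  rcases le_total ‖x‖ ‖w₀‖ with h | h
  · rcases le_total ‖w‖ ‖x‖ with h' | h'
    · exact h'
    · exact hmin ⟨hx, h⟩ h'
  · exact hw.2.trans h

end Lattice

/-- Only the competitors `w + v` and `w - v` matter. -/
lemma IsMinimalCompletion.abs_re_div_le {L : Submodule ℤ ℂ} {v w : ℂ}
    (h : IsMinimalCompletion L v w) : |(w / v).re| ≤ 1 / 2 := by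
  have hv : v ≠ 0 := ne_zero_of_cross_pos h.1.cross_pos
  have key : ∀ n : ℤ, ‖w / v‖ ≤ ‖w / v + n‖ := fun n => by
    have h1 := h.2 _ (h.1.add_zsmul n)
    have h2 : w / v + n = (w + n • v) / v := by
      rw [zsmul_eq_mul]; field_simp
    rw [h2, norm_div, norm_div]
    gcongr
  have sq : ∀ n : ℤ, 0 ≤ 2 * n * (w / v).re + (n : ℝ) ^ 2 := fun n => by
    have := pow_le_pow_left₀ (norm_nonneg _) (key n) 2
    rw [Complex.sq_norm, Complex.sq_norm, Complex.normSq_apply, Complex.normSq_apply] at this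
    simp only [Complex.add_re, Complex.add_im, Complex.intCast_re, Complex.intCast_im] at this
    nlinarith
  have h1 := sq 1
  have h2 := sq (-1)
  push_cast at h1 h2
  rw [abs_le]
  constructor <;> linarith

/-! ### Quadratic growth of the number of primitive vectors -/

/-- The number of nonzero vectors of `L` of norm at most `T`. -/
noncomputable def nonzeroCount (L : Submodule ℤ ℂ) (T : ℝ) : ℕ :=
  {v : ℂ | v ∈ L ∧ v ≠ 0 ∧ ‖v‖ ≤ T}.ncard

lemma finite_setOf_mem_ne_zero_norm_le (L : Submodule ℤ ℂ) [DiscreteTopology L] (T : ℝ) :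
    {v : ℂ | v ∈ L ∧ v ≠ 0 ∧ ‖v‖ ≤ T}.Finite :=
  (finite_setOf_mem_norm_le L T).subset fun _ hv => ⟨hv.1, hv.2.2⟩

lemma exists_pos_le_norm (L : Submodule ℤ ℂ) [DiscreteTopology L] :
    ∃ δ > 0, ∀ v ∈ L, v ≠ 0 → δ ≤ ‖v‖ := by
  rcases Set.eq_empty_or_nonempty {v : ℂ | v ∈ L ∧ v ≠ 0 ∧ ‖v‖ ≤ 1} with h | h
  · refine ⟨1, one_pos, fun v hv hv0 => ?_⟩
    by_contra hlt
    exact (h ▸ (⟨hv, hv0, (not_le.1 hlt).le⟩ : v ∈ {v : ℂ | v ∈ L ∧ v ≠ 0 ∧ ‖v‖ ≤ 1}) :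
      v ∈ (∅ : Set ℂ))
  · obtain ⟨w, hw, hmin⟩ :=
      (finite_setOf_mem_ne_zero_norm_le L 1).exists_minimalFor (fun v => ‖v‖) _ h
    refine ⟨‖w‖, norm_pos_iff.2 hw.2.1, fun v hv hv0 => ?_⟩
    by_contra hlt
    have hlt' := (not_le.1 hlt).le
    exact hlt (hmin ⟨hv, hv0, hlt'.trans hw.2.2⟩ hlt')

lemma tendsto_nonzeroCount_div_sq (L : Submodule ℤ ℂ) [DiscreteTopology L] [IsZLattice ℝ L] :
    ∃ c > 0, Tendsto (fun T : ℝ => (nonzeroCount L T : ℝ) / T ^ 2) atTop (𝓝 c) := by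
  have hset : {x : ℂ | x ∈ Set.univ ∧ ‖x‖ ^ 2 ≤ 1} = Metric.closedBall 0 1 := by
    ext x
    simp
  have h := ZLattice.covolume.tendsto_card_le_div' L (X := Set.univ) (F := fun x : ℂ => ‖x‖ ^ 2)
    (fun _ _ _ _ => trivial)
    (fun x r hr => by
      simp [Complex.finrank_real_complex, mul_pow])
    (by rw [hset]; exact Metric.isBounded_closedBall)
    (by rw [hset]; exact Metric.isClosed_closedBall.measurableSet)
    (by rw [hset, frontier_closedBall _ one_ne_zero]; exact MeasureTheory.Measure.addHaar_sphere _ _ _)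
  refine ⟨MeasureTheory.volume.real (Metric.closedBall (0 : ℂ) 1) / ZLattice.covolume L, ?_, ?_⟩
  · refine div_pos ?_ (ZLattice.covolume_pos L _)
    exact ENNReal.toReal_pos (Metric.measure_closedBall_pos _ _ one_pos).ne'
      MeasureTheory.measure_closedBall_lt_top.ne
  · rw [hset] at h
    -- The lattice-point count includes the origin; subtracting 1/T² removes it.
    have h2 := (h.comp (tendsto_pow_atTop (two_ne_zero))).sub
      (tendsto_inv_atTop_zero.comp (tendsto_pow_atTop (α := ℝ) (two_ne_zero)))
    rw [sub_zero] at h2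
    refine h2.congr' ?_
    filter_upwards [eventually_ge_atTop 0] with T hT
    have hcard : Nat.card ({x : ℂ | x ∈ Set.univ ∧ ‖x‖ ^ 2 ≤ T ^ 2} ∩ L : Set ℂ)
        = nonzeroCount L T + 1 := by
      rw [nonzeroCount, ← Set.ncard_insert_of_notMem (a := (0 : ℂ)) (by simp)
        (finite_setOf_mem_ne_zero_norm_le L T)]
      rw [Nat.card_coe_set_eq]
      congr 1
      ext x
      simp only [Set.mem_univ, true_and, Set.mem_inter_iff, Set.mem_ofPred_eq, SetLike.mem_coe,
        Set.mem_insert_iff, pow_le_pow_iff_left₀ (norm_nonneg x) hT two_ne_zero]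
      by_cases hx : x = 0
      · simp [hx, hT]
      · simp [hx, and_comm]
    simp only [Function.comp_apply]
    rw [hcard]
    push_cast
    ring

/-- Provides the dominating series for Möbius inversion, where `T / d` becomes arbitrarily small. A
bound valid down to zero is possible because the origin is not counted: the count vanishes below the
shortest length δ. -/
lemma exists_nonzeroCount_le (L : Submodule ℤ ℂ) [DiscreteTopology L] [IsZLattice ℝ L] :
    ∃ C, ∀ T : ℝ, 0 ≤ T → (nonzeroCount L T : ℝ) ≤ C * T ^ 2 := by
  obtain ⟨c, hc, h⟩ := tendsto_nonzeroCount_div_sq L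
  obtain ⟨T₀, hT₀⟩ := eventually_atTop.1
    ((h.eventually_lt_const (lt_add_one c)).and (eventually_gt_atTop 0))
  obtain ⟨δ, hδ, hL⟩ := exists_pos_le_norm L
  have hT₀' := (hT₀ T₀ le_rfl).2
  refine ⟨c + 1 + nonzeroCount L T₀ / δ ^ 2, fun T hT => ?_⟩
  have hn : 0 ≤ (nonzeroCount L T₀ : ℝ) / δ ^ 2 := by positivity
  rcases le_total T₀ T with h1 | h1
  · obtain ⟨h2, h3⟩ := hT₀ T h1
    rw [div_lt_iff₀ (by positivity)] at h2
    nlinarith [sq_nonneg T]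
  · rcases lt_or_ge T δ with h2 | h2
    · have : nonzeroCount L T = 0 := by
        rw [nonzeroCount, Set.ncard_eq_zero (finite_setOf_mem_ne_zero_norm_le L T)]
        ext v
        simp only [Set.mem_ofPred_eq, Set.mem_empty_iff_false, iff_false]
        rintro ⟨h3, h4, h5⟩
        linarith [hL v h3 h4]
      rw [this]
      push_cast
      positivity
    · have h3 : (nonzeroCount L T : ℝ) ≤ nonzeroCount L T₀ := by
        rw [Nat.cast_le]
        exact Set.ncard_le_ncard (fun v hv => ⟨hv.1, hv.2.1, hv.2.2.trans h1⟩)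
          (finite_setOf_mem_ne_zero_norm_le L T₀)
      have h4 : (nonzeroCount L T₀ : ℝ) ≤ nonzeroCount L T₀ / δ ^ 2 * T ^ 2 := by
        rw [div_mul_eq_mul_div, le_div_iff₀ (by positivity)]
        gcongr
      nlinarith [sq_nonneg T]

/-- The content `g` is the gcd of the coordinates; its divisors index the terms of the Möbius
inversion. -/
lemma IsPositiveBasis.exists_content {L : Submodule ℤ ℂ} {e₁ e₂ v : ℂ}
    (h : IsPositiveBasis L e₁ e₂) (hv : v ∈ L) (hv0 : v ≠ 0) :
    ∃ g : ℕ, g ≠ 0 ∧ (∀ d : ℕ, d ∣ g ↔ ∃ w ∈ L, v = (d : ℤ) • w) ∧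
      (IsPrimitiveVector L v ↔ g = 1) := by
  obtain ⟨a, b, rfl⟩ := h.exists_coords hv
  refine ⟨Int.gcd a b, ?_, fun d => ⟨fun hd => ?_, ?_⟩, h.isPrimitiveVector_iff⟩
  · rw [Ne, Int.gcd_eq_zero_iff]
    rintro ⟨rfl, rfl⟩
    simp at hv0
  · obtain ⟨a', ha⟩ := (Int.natCast_dvd_natCast.2 hd).trans (Int.gcd_dvd_left a b)
    obtain ⟨b', hb⟩ := (Int.natCast_dvd_natCast.2 hd).trans (Int.gcd_dvd_right a b)
    exact ⟨a' • e₁ + b' • e₂,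
      L.add_mem (L.smul_mem _ h.mem_left) (L.smul_mem _ h.mem_right), by
        rw [smul_add, ← mul_smul, ← mul_smul, ← ha, ← hb]⟩
  · rintro ⟨w, hw, hvw⟩
    obtain ⟨a', b', rfl⟩ := h.exists_coords hw
    rw [smul_add, ← mul_smul, ← mul_smul] at hvw
    obtain ⟨rfl, rfl⟩ := coords_injective_of_cross_ne_zero h.cross_pos.ne' hvw
    rw [← Int.natCast_dvd_natCast]
    exact Int.dvd_coe_gcd (dvd_mul_right _ _) (dvd_mul_right _ _)

open ArithmeticFunction in
lemma sum_divisors_moebius (n : ℕ) :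
    ∑ d ∈ n.divisors, (moebius d : ℝ) = if n = 1 then 1 else 0 := by
  have h := congrArg (fun f : ArithmeticFunction ℤ => f n) moebius_mul_coe_zeta
  simp only [coe_mul_zeta_apply, one_apply] at h
  exact_mod_cast h

open ArithmeticFunction in
lemma ncard_primitiveVectors_eq_tsum (L : Submodule ℤ ℂ) [DiscreteTopology L] [IsZLattice ℝ L]
    (T : ℝ) :
    ((primitiveVectors L T).ncard : ℝ) =
      ∑' d : ℕ, (moebius d : ℝ) * nonzeroCount L (T / d) := by
  classical
  obtain ⟨e₁, e₂, he⟩ := exists_isPositiveBasis L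
  have hfin := finite_setOf_mem_ne_zero_norm_le L T
  set S := hfin.toFinset with hS
  have hmem : ∀ v, v ∈ S ↔ v ∈ L ∧ v ≠ 0 ∧ ‖v‖ ≤ T := fun v => by simp [hS]
  have hg : ∀ v : ℂ, ∃ g : ℕ, v ∈ S → g ≠ 0 ∧ (∀ d : ℕ, d ∣ g ↔ ∃ w ∈ L, v = (d : ℤ) • w) ∧
      (IsPrimitiveVector L v ↔ g = 1) := fun v => by
    by_cases hv : v ∈ S
    · obtain ⟨h1, h2, -⟩ := (hmem v).1 hv
      obtain ⟨g, hg⟩ := he.exists_content h1 h2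
      exact ⟨g, fun _ => hg⟩
    · exact ⟨0, fun h => absurd h hv⟩
  choose g hg using hg
  -- Multiplication by `d` carries the vectors of norm at most `T / d` to those of norm at most `T`
  -- divisible by `d`.
  have hcount : ∀ d : ℕ, d ≠ 0 → nonzeroCount L (T / d) = (S.filter (fun v => d ∣ g v)).card := by
    intro d hd
    have hd' : (0 : ℝ) < d := by positivity
    have hdC : (d : ℂ) ≠ 0 := by exact_mod_cast hd
    have hinj : Function.Injective (fun w : ℂ => (d : ℤ) • w) := fun x y hxy => by
      simpa [hdC] using hxy
    rw [nonzeroCount, ← Set.ncard_image_of_injective _ hinj, ← Set.ncard_coe_finset]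
    congr 1
    ext v
    simp only [Set.mem_image, Set.mem_ofPred_eq, Finset.coe_filter]
    constructor
    · rintro ⟨w, ⟨h1, h2, h3⟩, rfl⟩
      have hvS : (d : ℤ) • w ∈ S := by
        rw [hmem]
        refine ⟨L.smul_mem _ h1, by simp [hd, h2], ?_⟩
        rw [le_div_iff₀ hd'] at h3
        simpa [mul_comm] using h3
      exact ⟨hvS, ((hg _ hvS).2.1 d).2 ⟨w, h1, rfl⟩⟩
    · rintro ⟨hvS, hdv⟩
      obtain ⟨w, hw, rfl⟩ := ((hg _ hvS).2.1 d).1 hdv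
      obtain ⟨-, h2, h3⟩ := (hmem _).1 hvS
      refine ⟨w, ⟨hw, fun h => h2 (by simp [h]), ?_⟩, rfl⟩
      rw [le_div_iff₀ hd']
      simpa [mul_comm] using h3
  set K := S.sup g + 1 with hK
  have hlt : ∀ v ∈ S, g v < K := fun v hv => Nat.lt_succ_of_le (Finset.le_sup hv)
  have hzero : ∀ d ∉ Finset.range K, (moebius d : ℝ) * nonzeroCount L (T / d) = 0 := by
    intro d hd
    rw [Finset.mem_range, not_lt] at hd
    rw [hcount d (by omega), Finset.card_eq_zero.2, Nat.cast_zero, mul_zero]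
    rw [Finset.filter_eq_empty_iff]
    intro v hv hdv
    have := Nat.le_of_dvd (Nat.pos_of_ne_zero (hg v hv).1) hdv
    have := hlt v hv
    omega
  rw [tsum_eq_sum hzero]
  have hterm : ∀ d ∈ Finset.range K, (moebius d : ℝ) * nonzeroCount L (T / d) =
      ∑ v ∈ S, if d ∣ g v then (moebius d : ℝ) else 0 := by
    intro d _
    -- The index `d = 0` is harmless because the Möbius function vanishes there.
    rcases eq_or_ne d 0 with rfl | hd
    · simp
    · rw [hcount d hd, ← Finset.sum_filter, Finset.sum_const, nsmul_eq_mul, mul_comm]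
  rw [Finset.sum_congr rfl hterm, Finset.sum_comm]
  have hinner : ∀ v ∈ S, ∑ d ∈ Finset.range K, (if d ∣ g v then (moebius d : ℝ) else 0) =
      if IsPrimitiveVector L v then 1 else 0 := by
    intro v hv
    rw [← Finset.sum_filter]
    have : (Finset.range K).filter (fun d => d ∣ g v) = (g v).divisors := by
      ext d
      simp only [Finset.mem_filter, Finset.mem_range, Nat.mem_divisors]
      refine ⟨fun h => ⟨h.2, (hg v hv).1⟩, fun h => ⟨?_, h.1⟩⟩
      exact (Nat.le_of_dvd (Nat.pos_of_ne_zero h.2) h.1).trans_lt (hlt v hv)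
    rw [this, sum_divisors_moebius]
    simp only [(hg v hv).2.2]
  rw [Finset.sum_congr rfl hinner, Finset.sum_boole, ← Set.ncard_coe_finset]
  congr 2
  ext v
  simp only [primitiveVectors, Finset.coe_filter, Set.mem_ofPred_eq, hmem]
  constructor
  · rintro ⟨h1, h2⟩
    refine ⟨⟨h1.1, ?_, h2⟩, h1⟩
    rintro rfl
    have := h1.2 0 L.zero_mem 0 (by simp)
    omega
  · rintro ⟨h1, h2⟩
    exact ⟨h2, h1.2.2⟩

open ArithmeticFunction in
-- The sum is 1/ζ(2) = 6/π²; only its sign is needed, since the growth constant cancels in the final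
-- ratio.
lemma tsum_moebius_div_sq_pos : 0 < ∑' d : ℕ, (moebius d : ℝ) / (d : ℝ) ^ 2 := by
  have h := LSeries_one_mul_Lseries_moebius (s := 2) (by simp)
  rw [LSeries_one_eq_riemannZeta (by simp), riemannZeta_two] at h
  have hS : LSeries (fun n => ((moebius n : ℤ) : ℂ)) 2 =
      ((∑' d : ℕ, (moebius d : ℝ) / (d : ℝ) ^ 2 : ℝ) : ℂ) := by
    rw [LSeries, Complex.ofReal_tsum]
    refine tsum_congr fun n => ?_
    rcases eq_or_ne n 0 with rfl | hn
    · simp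
    · rw [LSeries.term_of_ne_zero hn]
      push_cast
      norm_cast
  rw [hS] at h
  have h' : Real.pi ^ 2 / 6 * ∑' d : ℕ, (moebius d : ℝ) / (d : ℝ) ^ 2 = 1 := by exact_mod_cast h
  by_contra hn
  nlinarith [sq_nonneg Real.pi]

open ArithmeticFunction in
lemma tendsto_ncard_primitiveVectors_div_sq (L : Submodule ℤ ℂ) [DiscreteTopology L]
    [IsZLattice ℝ L] :
    ∃ c > 0, Tendsto (fun T : ℝ => ((primitiveVectors L T).ncard : ℝ) / T ^ 2) atTop (𝓝 c) := by
  obtain ⟨c, hc, h⟩ := tendsto_nonzeroCount_div_sq L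
  obtain ⟨C, hC⟩ := exists_nonzeroCount_le L
  have hlim : Tendsto (fun T : ℝ => ∑' d : ℕ, (moebius d : ℝ) * nonzeroCount L (T / d) / T ^ 2)
      atTop (𝓝 (∑' d : ℕ, c * ((moebius d : ℝ) / (d : ℝ) ^ 2))) := by
    refine tendsto_tsum_of_dominated_convergence (bound := fun d : ℕ => C * (1 / (d : ℝ) ^ 2)) ?_ ?_ ?_
    · exact (Real.summable_one_div_nat_pow.2 one_lt_two).mul_left _
    · intro d
      rcases eq_or_ne d 0 with rfl | hd
      · simp
      have hd' : (0 : ℝ) < d := by positivity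
      have := (h.comp (tendsto_id.atTop_div_const hd')).const_mul ((moebius d : ℝ) / (d : ℝ) ^ 2)
      rw [mul_comm c]
      refine this.congr fun T => ?_
      simp only [Function.comp_apply, id]
      field_simp
    · filter_upwards [eventually_gt_atTop 0] with T hT d
      rcases eq_or_ne d 0 with rfl | hd
      · simp
      have hd' : (0 : ℝ) < d := by positivity
      have h1 := hC (T / d) (by positivity)
      have h2 : |(moebius d : ℝ)| ≤ 1 := by exact_mod_cast abs_moebius_le_one
      rw [Real.norm_eq_abs, abs_div, abs_mul, abs_of_pos (by positivity : (0 : ℝ) < T ^ 2),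
        div_le_iff₀ (by positivity), Nat.abs_cast]
      calc |(moebius d : ℝ)| * nonzeroCount L (T / d) ≤ 1 * (C * (T / d) ^ 2) := by gcongr
        _ = _ := by field_simp
  refine ⟨_, ?_, hlim.congr fun T => ?_⟩
  · rw [tsum_mul_left]
    exact mul_pos hc tsum_moebius_div_sq_pos
  · rw [ncard_primitiveVectors_eq_tsum, tsum_div_const]

/-! ### Lower bound for an arc next to a fraction -/

/-- The primitive vectors `v` of norm at most `T` having a positively oriented completion `w` with
`Re (w / v)` in `E`. -/
def vectorsWithRatioIn (L : Submodule ℤ ℂ) (E : Set ℝ) (T : ℝ) : Set ℂ :=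
  {v | v ∈ primitiveVectors L T ∧ ∃ w, IsPositiveBasis L v w ∧ (w / v).re ∈ E}

lemma vectorsWithRatioIn_subset (L : Submodule ℤ ℂ) (E : Set ℝ) (T : ℝ) :
    vectorsWithRatioIn L E T ⊆ primitiveVectors L T := fun _ hv => hv.1

lemma IsPositiveBasis.eq_of_re_div_mem_Ioo {L : Submodule ℤ ℂ} {v w w' : ℂ} {α β : ℝ}
    (h : IsPositiveBasis L v w) (h' : IsPositiveBasis L v w') (hαβ : β ≤ α + 1)
    (hw : (w / v).re ∈ Set.Ioo α β) (hw' : (w' / v).re ∈ Set.Ioo α β) : w' = w := by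
  obtain ⟨n, rfl⟩ := h.exists_eq_add_zsmul h'
  have hv : v ≠ 0 := ne_zero_of_cross_pos h.cross_pos
  have h1 : (w + n • v) / v = w / v + n := by rw [zsmul_eq_mul]; field_simp
  rw [h1, Complex.add_re, Complex.intCast_re] at hw'
  have h2 : (n : ℝ) < 1 := by linarith [hw.1, hw'.2]
  have h3 : (-1 : ℝ) < n := by linarith [hw.2, hw'.1]
  have h4 : n < 1 := by exact_mod_cast h2
  have h5 : -1 < n := by exact_mod_cast h3
  have h6 : n = 0 := by omega
  simp [h6]

lemma sum_ncard_le_ncard {ι X : Type*} (s : Finset ι) (V : ι → Set X) {A : Set X}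
    (hA : A.Finite) (hV : ∀ i ∈ s, V i ⊆ A)
    (hd : ∀ i ∈ s, ∀ j ∈ s, ∀ x, x ∈ V i → x ∈ V j → i = j) :
    ∑ i ∈ s, (V i).ncard ≤ A.ncard := by
  classical
  have hfin : ∀ i ∈ s, (V i).Finite := fun i hi => hA.subset (hV i hi)
  let W : ι → Finset X := fun i => hA.toFinset.filter (· ∈ V i)
  have hW : ∀ i ∈ s, (V i).ncard = (W i).card := fun i hi => by
    rw [← Set.ncard_coe_finset]
    congr 1
    ext x
    simp only [W, Finset.coe_filter, Set.Finite.mem_toFinset, Set.mem_ofPred_eq]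
    exact ⟨fun h => ⟨hV i hi h, h⟩, fun h => h.2⟩
  rw [Finset.sum_congr rfl hW, ← Finset.card_biUnion, Set.ncard_eq_toFinset_card A hA]
  · refine Finset.card_le_card fun x hx => ?_
    obtain ⟨i, -, hx⟩ := Finset.mem_biUnion.1 hx
    exact (Finset.mem_filter.1 hx).1
  · intro i hi j hj hij
    rw [Function.onFun]
    rw [Finset.disjoint_left]
    intro x hx hx'
    exact hij (hd i hi j hj x (Finset.mem_filter.1 hx).2 (Finset.mem_filter.1 hx').2)

/-- A Bézout relation for `p`, `q` inverts w = q v' - p v unimodularly. Replacing `u` by `u + n • w`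
shifts `v / w` by -qn, so a suitable `n` puts its real part in any prescribed window of length `q`.
-/
lemma IsPositiveBasis.exists_basis_of_combination {L : Submodule ℤ ℂ} {w u : ℂ}
    (h : IsPositiveBasis L w u) {p q : ℤ} (hq : 0 < q) (hpq : IsCoprime p q) (K : ℤ) :
    ∃ v v' : ℂ, IsPositiveBasis L v v' ∧ w = q • v' - p • v ∧
      (v / w).re ∈ Set.Ioc (q * (K - 1) : ℝ) (q * K) ∧
      (v / w).im = -(q * cross w u / ‖w‖ ^ 2) := by
  obtain ⟨s, r, hsr⟩ := hpq
  have hw : w ≠ 0 := ne_zero_of_cross_pos h.cross_pos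
  have hqR : (0 : ℝ) < q := by exact_mod_cast hq
  set y : ℝ := -(s : ℝ) / q - (u / w).re with hy
  set n : ℤ := ⌈y⌉ - K with hn
  have hU := h.add_zsmul n
  have hUw : (u + n • w) / w = u / w + n := by rw [zsmul_eq_mul]; field_simp
  have hv : ((-s) • w + (-q) • (u + n • w)) / w = -s - q * (u / w + n) := by
    rw [← hUw]; simp only [zsmul_eq_mul]; push_cast; field_simp; ring
  have hm : ∀ m n' : ℤ, m • w + n' • (u + n • w) ∈ L := fun m n' =>
    L.add_mem (L.smul_mem _ hU.mem_left) (L.smul_mem _ hU.mem_right)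
  refine ⟨(-s) • w + (-q) • (u + n • w), r • w + (-p) • (u + n • w), ?_, ?_, ?_, ?_⟩
  · refine hU.iff_cross_eq.2 ⟨hm _ _, hm _ _, ?_⟩
    rw [cross_zsmul_add_zsmul, show -s * -p - r * -q = 1 by linarith]
    simp
  · have hsr' : (s * p + r * q : ℂ) = 1 := by exact_mod_cast hsr
    simp only [zsmul_eq_mul]
    push_cast
    linear_combination (-w) * hsr'
  · rw [hv]
    have : (-(s : ℂ) - q * (u / w + n)).re = q * (y - n) := by
      simp [hy]; field_simp; ring
    rw [this, hn]
    push_cast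
    have h1 := Int.le_ceil y
    have h2 := Int.ceil_lt_add_one y
    constructor
    · exact mul_lt_mul_of_pos_left (by linarith) hqR
    · exact mul_le_mul_of_nonneg_left (by linarith) hqR.le
  · rw [hv]
    simp [im_div_eq_cross]
    ring

/-- With z = v/w, the offset of Re(v'/v) from p/q is Re(1/z)/q, and 0 < Re(1/z) ≤ 1/Re z. -/
lemma re_div_mem_Ioo_of_combination {v v' w : ℂ} (hv : v ≠ 0) {p q : ℤ} (hq : 0 < q)
    {k : ℝ} (hk : 0 < k) (hw : w = q • v' - p • v) (hx : q * k < (v / w).re) :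
    (v' / v).re ∈ Set.Ioo (p / q : ℝ) (p / q + 1 / (k * q ^ 2)) := by
  have hqR : (0 : ℝ) < q := by exact_mod_cast hq
  have hx0 : 0 < (v / w).re := lt_trans (by positivity) hx
  have h1 : w / v = q * (v' / v) - p := by
    rw [hw]; simp only [zsmul_eq_mul]; field_simp
  have h2 : (w / v).re = q * (v' / v).re - p := by rw [h1]; simp
  have h3 : (w / v).re = (v / w).re / Complex.normSq (v / w) := by
    rw [← inv_div, Complex.inv_re]
  have hns : (v / w).re ^ 2 ≤ Complex.normSq (v / w) := by
    rw [Complex.normSq_apply]; nlinarith [mul_self_nonneg (v / w).im]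
  have hns0 : 0 < Complex.normSq (v / w) := lt_of_lt_of_le (by positivity) hns
  have h4 : 0 < (w / v).re := by rw [h3]; positivity
  have h5 : (w / v).re < 1 / (q * k) := by
    rw [h3, div_lt_div_iff₀ hns0 (by positivity)]
    nlinarith
  rw [h2] at h4 h5
  constructor
  · rw [div_lt_iff₀ hqR]; linarith
  · have : (v' / v).re - p / q < 1 / (k * q ^ 2) := by
      have h6 : (v' / v).re - p / q = (q * (v' / v).re - p) / q := by field_simp
      rw [h6, div_lt_iff₀ hqR]
      calc _ < 1 / (q * k) := h5
        _ = _ := by field_simp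
    linarith

lemma norm_le_of_re_div_le {v w : ℂ} (hw0 : w ≠ 0) {X Y : ℝ} (hX : |(v / w).re| ≤ X)
    (hY : |(v / w).im| ≤ Y) : ‖v‖ ≤ ‖w‖ * X + ‖w‖ * Y := by
  have h : ‖v‖ = ‖w‖ * ‖v / w‖ := by
    rw [norm_div]; field_simp
  rw [h, ← mul_add]
  have := Complex.norm_le_abs_re_add_abs_im (v / w)
  gcongr
  linarith

lemma exists_sum_ncard_le_ncard_vectorsWithRatioIn (L : Submodule ℤ ℂ) [DiscreteTopology L]
    [IsZLattice ℝ L] {p q : ℤ} (hq : 0 < q) (hpq : IsCoprime p q) {k : ℕ} (hk : 0 < k) :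
    ∃ B : ℝ, ∀ (M : ℕ) (T : ℝ),
      ∑ m ∈ Finset.Icc 1 M, (primitiveVectors L ((T - B) / (q * (k + m)))).ncard ≤
        (vectorsWithRatioIn L (Set.Ioo (p / q : ℝ) (p / q + 1 / (k * q ^ 2))) T).ncard := by
  classical
  obtain ⟨e₁, e₂, he⟩ := exists_isPositiveBasis L
  obtain ⟨δ, hδ, hL⟩ := exists_pos_le_norm L
  have hqR : (0 : ℝ) < q := by exact_mod_cast hq
  have hq1 : (1 : ℝ) ≤ q := by exact_mod_cast hq
  have hk1 : (1 : ℝ) ≤ k := by exact_mod_cast hk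
  have hlen : (p / q + 1 / (k * q ^ 2) : ℝ) ≤ p / q + 1 := by
    have : (1 : ℝ) ≤ k * q ^ 2 := by nlinarith
    gcongr
    rw [div_le_one (by positivity)]
    exact this
  have hA := he.cross_pos
  -- This bounds the contribution |w| |Im(v/w)| = qA/|w| to |v|, since |w| ≥ δ.
  refine ⟨q * cross e₁ e₂ / δ, fun M T => ?_⟩
  set E : Set ℝ := Set.Ioo (p / q : ℝ) (p / q + 1 / (k * q ^ 2)) with hE
  let V : ℕ → Set ℂ := fun m => {v | v ∈ primitiveVectors L T ∧ ∃ v', IsPositiveBasis L v v' ∧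
    (v' / v).re ∈ E ∧
      (v / (q • v' - p • v)).re ∈ Set.Ioc (q * ((k + m : ℤ) - 1) : ℝ) (q * (k + m : ℤ))}
  have hfin : (vectorsWithRatioIn L E T).Finite :=
    (finite_primitiveVectors L T).subset (vectorsWithRatioIn_subset L E T)
  have hVsub : ∀ m, V m ⊆ vectorsWithRatioIn L E T := by
    rintro m v ⟨hv, v', h1, h2, -⟩
    exact ⟨hv, v', h1, h2⟩
  refine le_trans (Finset.sum_le_sum fun m hm => ?_)
    (sum_ncard_le_ncard (Finset.Icc 1 M) V hfin (fun m _ => hVsub m) ?_)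
  · have hm1 : 1 ≤ m := (Finset.mem_Icc.1 hm).1
    have hm1R : (1 : ℝ) ≤ m := by exact_mod_cast hm1
    have hex : ∀ w : ℂ, ∃ v : ℂ, IsPrimitiveVector L w ∧
        ‖w‖ ≤ (T - q * cross e₁ e₂ / δ) / (q * (k + m)) →
        v ∈ V m ∧ ∃ v', IsPositiveBasis L v v' ∧ (v' / v).re ∈ E ∧ w = q • v' - p • v := by
      intro w
      by_cases hw : IsPrimitiveVector L w ∧ ‖w‖ ≤ (T - q * cross e₁ e₂ / δ) / (q * (k + m))
      · obtain ⟨u, hu⟩ := he.exists_completion hw.1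
        have hw0 : w ≠ 0 := ne_zero_of_cross_pos hu.cross_pos
        obtain ⟨v, v', hvv', hwv, hre, him⟩ := hu.exists_basis_of_combination hq hpq (k + m : ℤ)
        have hv0 : v ≠ 0 := ne_zero_of_cross_pos hvv'.cross_pos
        have hEmem : (v' / v).re ∈ E := by
          refine re_div_mem_Ioo_of_combination hv0 hq (by positivity) hwv ?_
          refine lt_of_le_of_lt ?_ hre.1
          push_cast
          gcongr
          linarith
        have hxpos : 0 < (v / w).re := by
          refine lt_of_le_of_lt ?_ hre.1
          push_cast
          exact mul_nonneg hqR.le (by linarith)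
        have hcr : cross w u = cross e₁ e₂ := (he.iff_cross_eq.1 hu).2.2
        have hnorm : ‖v‖ ≤ T := by
          have h1 := norm_le_of_re_div_le hw0 (X := q * (k + m)) (Y := q * cross e₁ e₂ / ‖w‖ ^ 2)
            (by rw [abs_of_pos hxpos]; exact_mod_cast hre.2)
            (by rw [him, hcr, abs_neg, abs_of_pos]; have := norm_pos_iff.2 hw0; positivity)
          have h2 : ‖w‖ * (q * cross e₁ e₂ / ‖w‖ ^ 2) ≤ q * cross e₁ e₂ / δ := by
            have h3 := hL w hw.1.1 hw0
            have h4 := norm_pos_iff.2 hw0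
            have h5 : ‖w‖ * (q * cross e₁ e₂ / ‖w‖ ^ 2) = q * cross e₁ e₂ / ‖w‖ := by
              field_simp
            rw [h5]
            gcongr
          have h6 := hw.2
          rw [le_div_iff₀ (by positivity)] at h6
          linarith
        refine ⟨v, fun _ => ⟨⟨⟨hvv'.isPrimitiveVector, hnorm⟩, v', hvv', hEmem, ?_⟩,
          v', hvv', hEmem, hwv⟩⟩
        rw [← hwv]
        exact_mod_cast hre
      · exact ⟨0, fun h => absurd h hw⟩
    choose f hf using hex
    -- Injectivity: the arc has length at most one, so `v` determines `v'`, and hence w = q v' - p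
    -- v.
    refine Set.ncard_le_ncard_of_injOn f (fun w hw => (hf w hw).1) ?_ (hfin.subset (hVsub m))
    intro w₁ hw₁ w₂ hw₂ heq
    obtain ⟨-, v₁, h1, h2, h3⟩ := hf w₁ hw₁
    obtain ⟨-, v₂, h4, h5, h6⟩ := hf w₂ hw₂
    rw [← heq] at h4 h5 h6
    rw [h3, h6, h1.eq_of_re_div_mem_Ioo h4 hlen h2 h5]
  -- Again `v` determines `v'`, and the half-open windows for different indices are disjoint.
  · rintro i - j - v ⟨-, v₁, h1, h2, h3⟩ ⟨-, v₂, h4, h5, h6⟩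
    rw [h1.eq_of_re_div_mem_Ioo h4 hlen h2 h5] at h6
    have h7 := lt_of_mul_lt_mul_left (h3.1.trans_le h6.2) hqR.le
    have h8 := lt_of_mul_lt_mul_left (h6.1.trans_le h3.2) hqR.le
    have h9 : (k + i : ℤ) - 1 < k + j := by exact_mod_cast h7
    have h10 : (k + j : ℤ) - 1 < k + i := by exact_mod_cast h8
    omega

/-- Telescoping of 1/x - 1/(x+1) ≤ 1/x². -/
lemma inv_sub_inv_le_sum_inv_sq {k : ℕ} (hk : 0 < k) (M : ℕ) :
    1 / (k + 1 : ℝ) - 1 / (k + M + 1) ≤ ∑ m ∈ Finset.Icc 1 M, 1 / (k + m : ℝ) ^ 2 := by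
  have hk1 : (0 : ℝ) < k := by exact_mod_cast hk
  induction M with
  | zero => simp
  | succ M ih =>
    rw [Finset.sum_Icc_succ_top (by omega)]
    have : 1 / (k + M + 1 : ℝ) - 1 / (k + (M + 1 : ℕ) + 1) ≤ 1 / (k + (M + 1 : ℕ) : ℝ) ^ 2 := by
      push_cast
      rw [div_sub_div _ _ (by positivity) (by positivity),
        div_le_div_iff₀ (by positivity) (by positivity)]
      nlinarith [(Nat.cast_nonneg M : (0 : ℝ) ≤ M)]
    linarith

lemma eventually_mul_sq_le_ncard_vectorsWithRatioIn (L : Submodule ℤ ℂ) [DiscreteTopology L]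
    [IsZLattice ℝ L] {c : ℝ} (hc : 0 < c)
    (h : Tendsto (fun T : ℝ => ((primitiveVectors L T).ncard : ℝ) / T ^ 2) atTop (𝓝 c))
    {p q : ℤ} (hq : 0 < q) (hpq : IsCoprime p q) {k : ℕ} (hk : 0 < k) {a : ℝ}
    (ha : a < c * (1 / (q ^ 2 * (k + 1)))) :
    ∀ᶠ T : ℝ in atTop, a * T ^ 2 ≤
      (vectorsWithRatioIn L (Set.Ioo (p / q : ℝ) (p / q + 1 / (k * q ^ 2))) T).ncard := by
  obtain ⟨B, hB⟩ := exists_sum_ncard_le_ncard_vectorsWithRatioIn L hq hpq hk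
  have hqR : (0 : ℝ) < q := by exact_mod_cast hq
  have hk0 : (0 : ℝ) < k := by exact_mod_cast hk
  -- Truncating the sum over windows leaves finitely many limits in `T`.
  obtain ⟨M, hM⟩ : ∃ M : ℕ, a < c / q ^ 2 * (1 / (k + 1 : ℝ) - 1 / (k + M + 1)) := by
    have h1 : Tendsto (fun M : ℕ => (1 : ℝ) / (k + M + 1)) atTop (𝓝 0) := by
      refine Tendsto.div_atTop tendsto_const_nhds ?_
      exact tendsto_atTop_add_const_right _ _
        (tendsto_atTop_add_const_left _ _ tendsto_natCast_atTop_atTop)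
    have h2 := (tendsto_const_nhds (x := 1 / (k + 1 : ℝ))).sub h1
    rw [sub_zero] at h2
    have h3 := h2.const_mul (c / (q : ℝ) ^ 2)
    refine (h3.eventually_const_lt ?_).exists
    calc a < _ := ha
      _ = _ := by field_simp
  have hterm : ∀ m : ℕ, Tendsto (fun T : ℝ =>
      ((primitiveVectors L ((T - B) / (q * (k + m)))).ncard : ℝ) / T ^ 2) atTop
        (𝓝 (c / q ^ 2 * (1 / (k + m : ℝ) ^ 2))) := by
    intro m
    have hd : (0 : ℝ) < q * (k + m) := by positivity
    have h1 : Tendsto (fun T : ℝ => (T - B) / (q * (k + m))) atTop atTop :=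
      (tendsto_atTop_add_const_right _ (-B) tendsto_id).atTop_div_const hd
    have h2 : Tendsto (fun T : ℝ => (1 - B / T) / (q * (k + m))) atTop
        (𝓝 ((1 - 0) / (q * (k + m)))) :=
      (tendsto_const_nhds.sub (tendsto_const_nhds.div_atTop tendsto_id)).div_const _
    have h3 := (h.comp h1).mul (h2.pow 2)
    have h4 : c * ((1 - 0) / (q * (k + m) : ℝ)) ^ 2 = c / q ^ 2 * (1 / (k + m : ℝ) ^ 2) := by
      rw [sub_zero]; field_simp
    rw [h4] at h3
    refine h3.congr' ?_
    filter_upwards [eventually_gt_atTop 0, eventually_gt_atTop B] with T hT hTB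
    have : T - B ≠ 0 := by linarith
    simp only [Function.comp_apply]
    field_simp
  have hsum := tendsto_finsetSum (Finset.Icc 1 M) (fun m _ => hterm m)
  have hlt : a < ∑ m ∈ Finset.Icc 1 M, c / (q : ℝ) ^ 2 * (1 / (k + m : ℝ) ^ 2) := by
    rw [← Finset.mul_sum]
    refine hM.trans_le ?_
    gcongr
    exact inv_sub_inv_le_sum_inv_sq hk M
  filter_upwards [hsum.eventually_const_lt hlt, eventually_gt_atTop 0] with T hT hT0
  rw [← Finset.sum_div, lt_div_iff₀ (by positivity)] at hT
  refine hT.le.trans ?_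
  exact_mod_cast hB M T

/-! ### Exhausting an interval by disjoint arcs next to fractions -/

/-- Bounded denominators would also bound the numerators, leaving only finitely many good
approximations. -/
lemma exists_rat_abs_sub_lt_one_div_den_sq_of_le_den {x : ℝ} (hx : Irrational x) (N : ℕ) :
    ∃ r : ℚ, |x - r| < 1 / (r.den : ℝ) ^ 2 ∧ N ≤ r.den := by
  by_contra! hcon
  refine Real.infinite_rat_abs_sub_lt_one_div_den_sq_of_irrational hx ?_
  set K : ℤ := ⌈(|x| + 1) * N⌉
  refine (((Finset.Icc (-K) K ×ˢ Finset.range N).image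
    (fun y : ℤ × ℕ => (y.1 : ℚ) / y.2)).finite_toSet).subset ?_
  intro r hr
  have hr : |x - r| < 1 / (r.den : ℝ) ^ 2 := hr
  have hden := hcon r hr
  have hdpos : (0 : ℝ) < r.den := by exact_mod_cast r.den_pos
  have hd1 : (1 : ℝ) ≤ r.den := by exact_mod_cast r.den_pos
  have hr1 : |x - r| < 1 := hr.trans_le (by
    rw [div_le_one (by positivity)]
    exact one_le_pow₀ hd1)
  have habs : |(r : ℝ)| ≤ |x| + 1 := by
    have := abs_sub_abs_le_abs_sub (r : ℝ) x
    rw [abs_sub_comm] at this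
    linarith
  have hnum : |(r.num : ℝ)| ≤ K := by
    have h1 : (r.num : ℝ) = r * r.den := by exact_mod_cast (Rat.mul_den_eq_num r).symm
    rw [h1, abs_mul, abs_of_pos hdpos]
    refine le_trans ?_ (Int.le_ceil _)
    have : (r.den : ℝ) ≤ N := by exact_mod_cast hden.le
    gcongr
  have hnum' : |r.num| ≤ K := by exact_mod_cast hnum
  rw [Finset.coe_image]
  refine ⟨(r.num, r.den), ?_, Rat.num_div_den r⟩
  simp only [Finset.coe_product, Finset.coe_Icc, Finset.coe_range, Set.mem_prod, Set.mem_Icc,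
    Set.mem_Iio]
  exact ⟨abs_le.1 hnum', hden⟩

open MeasureTheory in
-- Vitali's covering theorem for pairs (x, r) with `r` a good approximation of the irrational `x`.
-- The arc at `r` need not contain `x`, but it lies in a ball around `x` of comparable size, which
-- suffices.
lemma exists_finset_disjoint_arcs {α β : ℝ} {k : ℕ} (hk : 0 < k) {η : ℝ} (hη : 0 < η) :
    ∃ F : Finset ℚ, (∀ r ∈ F, Set.Icc (r : ℝ) (r + 1 / (k * (r.den : ℝ) ^ 2)) ⊆ Set.Ioo α β) ∧
      ((F : Set ℚ).PairwiseDisjoint fun r => Set.Icc (r : ℝ) (r + 1 / (k * (r.den : ℝ) ^ 2))) ∧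
      β - α - η ≤ ∑ r ∈ F, 1 / (k * (r.den : ℝ) ^ 2) := by
  classical
  have hk0 : (0 : ℝ) < k := by exact_mod_cast hk
  have hk1 : (1 : ℝ) ≤ k := by exact_mod_cast hk
  have hd0 : ∀ r : ℚ, (0 : ℝ) < r.den := fun r => by exact_mod_cast r.den_pos
  set len : ℚ → ℝ := fun r => 1 / (k * (r.den : ℝ) ^ 2) with hlen
  have hlen0 : ∀ r, 0 < len r := fun r => by have := hd0 r; positivity
  have hlen1 : ∀ r : ℚ, len r ≤ 1 / (r.den : ℝ) ^ 2 := fun r => by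
    have := hd0 r
    simp only [hlen]
    gcongr
    nlinarith [sq_nonneg (r.den : ℝ)]
  set B : ℝ × ℚ → Set ℝ := fun a => Set.Icc (a.2 : ℝ) (a.2 + len a.2) with hB
  set t : Set (ℝ × ℚ) := {a | |a.1 - a.2| < 1 / (a.2.den : ℝ) ^ 2 ∧ B a ⊆ Set.Ioo α β} with ht
  set s : Set ℝ := {x | x ∈ Set.Ioo α β ∧ Irrational x} with hs
  have hsub : ∀ a : ℝ × ℚ, |a.1 - a.2| < 1 / (a.2.den : ℝ) ^ 2 →
      B a ⊆ Metric.closedBall a.1 (2 / (a.2.den : ℝ) ^ 2) := by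
    intro a ha y hy
    have h1 := hlen1 a.2
    have h2 : 2 / (a.2.den : ℝ) ^ 2 = 1 / (a.2.den : ℝ) ^ 2 + 1 / (a.2.den : ℝ) ^ 2 := by ring
    rw [abs_lt] at ha
    rw [Metric.mem_closedBall, Real.dist_eq, abs_le]
    constructor <;> linarith [hy.1, hy.2]
  obtain ⟨u, hut, hucount, hudisj, hunull⟩ := Vitali.exists_disjoint_covering_ae volume s t
    -- The tripled ball has length 12/den², which is 12k times the length of the arc.
    (12 * k) (fun a => 2 / (a.2.den : ℝ) ^ 2) Prod.fst B (fun a ha => hsub a ha.1)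
    (by
      intro a _
      have := hd0 a.2
      rw [Real.volume_closedBall, Real.volume_Icc,
        show ((12 * k : NNReal) : ENNReal) = ENNReal.ofReal (12 * k) by
          rw [ENNReal.ofReal_mul (by norm_num)]; simp,
        ← ENNReal.ofReal_mul (by positivity)]
      apply le_of_eq
      congr 1
      simp only [hlen]
      field_simp
      ring)
    (by
      intro a _
      rw [interior_Icc, Set.nonempty_Ioo]
      linarith [hlen0 a.2])
    (fun a _ => isClosed_Icc)
    (by
      rintro x ⟨hx, hirr⟩ ε hε
      set m := min ε (min (x - α) (β - x)) with hm
      have hmpos : 0 < m := lt_min hε (lt_min (by linarith [hx.1]) (by linarith [hx.2]))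
      obtain ⟨N, hN⟩ := exists_nat_gt (2 / m)
      obtain ⟨r, hr, hrN⟩ := exists_rat_abs_sub_lt_one_div_den_sq_of_le_den hirr N
      have hrN' : (N : ℝ) ≤ r.den := by exact_mod_cast hrN
      have hd1 : (1 : ℝ) ≤ r.den := by exact_mod_cast r.den_pos
      have hlt : 2 / (r.den : ℝ) ^ 2 < m := by
        rw [div_lt_iff₀ (by positivity)]
        rw [div_lt_iff₀ hmpos] at hN
        have hNsq : (N : ℝ) ≤ (r.den : ℝ) ^ 2 := by nlinarith
        nlinarith
      refine ⟨(x, r), ⟨hr, fun y hy => ?_⟩, hlt.le.trans (min_le_left _ _), rfl⟩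
      have h1 := hsub (x, r) hr hy
      rw [Metric.mem_closedBall, Real.dist_eq, abs_le] at h1
      have h2 : m ≤ x - α := (min_le_right _ _).trans (min_le_left _ _)
      have h3 : m ≤ β - x := (min_le_right _ _).trans (min_le_right _ _)
      simp only at h1
      constructor <;> linarith [h1.1, h1.2])
  have hvol : ENNReal.ofReal (β - α) ≤ ∑' a : u, volume (B a) := by
    have h1 : volume (Set.Ioo α β \ s) = 0 := by
      refine measure_mono_null ?_ ((Set.countable_range ((↑) : ℚ → ℝ)).measure_zero volume)
      rintro x ⟨h1, h2⟩
      by_contra h3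
      exact h2 ⟨h1, h3⟩
    calc ENNReal.ofReal (β - α) = volume (Set.Ioo α β) := Real.volume_Ioo.symm
      _ ≤ volume ((Set.Ioo α β \ s) ∪ (s \ ⋃ a ∈ u, B a) ∪ ⋃ a ∈ u, B a) := by
          refine measure_mono fun x hx => ?_
          by_cases h1 : x ∈ s
          · by_cases h2 : x ∈ ⋃ a ∈ u, B a
            · exact Or.inr h2
            · exact Or.inl (Or.inr ⟨h1, h2⟩)
          · exact Or.inl (Or.inl ⟨hx, h1⟩)
      _ ≤ 0 + 0 + volume (⋃ a ∈ u, B a) := by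
          refine (measure_union_le _ _).trans ?_
          gcongr
          refine (measure_union_le _ _).trans ?_
          rw [h1, hunull]
      _ = ∑' a : u, volume (B a) := by
          rw [zero_add, zero_add, measure_biUnion hucount hudisj fun a _ => measurableSet_Icc]
  rcases le_or_gt (β - α) η with hle | hgt
  · exact ⟨∅, by simp, by simp, by simpa using hle⟩
  have hlt : ENNReal.ofReal (β - α - η) < ∑' a : u, volume (B a) :=
    lt_of_lt_of_le ((ENNReal.ofReal_lt_ofReal_iff (by linarith)).2 (by linarith)) hvol
  rw [ENNReal.tsum_eq_iSup_sum, lt_iSup_iff] at hlt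
  obtain ⟨G, hG⟩ := hlt
  -- Two pairs with the same fraction have the same nonempty arc, which disjointness forbids.
  have hinj : Set.InjOn (fun a : u => a.1.2) (G : Set u) := by
    intro a _ b _ hab
    by_contra hne
    have hdis := hudisj a.2 b.2 (fun h => hne (Subtype.ext h))
    have ha : (a.1.2 : ℝ) ∈ B a.1 := Set.left_mem_Icc.2 (by linarith [hlen0 a.1.2])
    refine Set.disjoint_left.1 hdis ha ?_
    have hab : a.1.2 = b.1.2 := hab
    rw [hab]
    exact Set.left_mem_Icc.2 (by linarith [hlen0 b.1.2])
  refine ⟨G.image fun a => a.1.2, ?_, ?_, ?_⟩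
  · intro r hr
    obtain ⟨a, -, rfl⟩ := Finset.mem_image.1 hr
    exact (hut a.2).2
  · intro r hr r' hr' hne
    obtain ⟨a, -, rfl⟩ := Finset.mem_image.1 (Finset.mem_coe.1 hr)
    obtain ⟨b, -, rfl⟩ := Finset.mem_image.1 (Finset.mem_coe.1 hr')
    exact hudisj a.2 b.2 (fun h => hne (by rw [h]))
  · rw [Finset.sum_image hinj]
    have h1 : ∑ a ∈ G, volume (B a) = ENNReal.ofReal (∑ a ∈ G, len a.1.2) := by
      rw [ENNReal.ofReal_sum_of_nonneg fun a _ => (hlen0 _).le]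
      refine Finset.sum_congr rfl fun a _ => ?_
      rw [Real.volume_Icc, add_sub_cancel_left]
    rw [h1] at hG
    exact (ENNReal.ofReal_lt_ofReal_iff'.1 hG).1.le

/-! ### Lower densities of intervals -/

/-- Among the primitive vectors of `L` of norm at most `T`, those with property `P` have
asymptotically at least the proportion `ℓ`. -/
def HasLowerDensity (L : Submodule ℤ ℂ) (P : ℂ → Prop) (ℓ : ℝ) : Prop :=
  ∀ η > 0, ∀ᶠ T : ℝ in atTop,
    (ℓ - η) * (primitiveVectors L T).ncard ≤ ({v ∈ primitiveVectors L T | P v}.ncard : ℝ)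

lemma hasLowerDensity_of_re_div_mem_Ioo (L : Submodule ℤ ℂ) [DiscreteTopology L] [IsZLattice ℝ L]
    {α β : ℝ} (h1 : β ≤ α + 1) :
    HasLowerDensity L (fun v => ∃ w, IsPositiveBasis L v w ∧ (w / v).re ∈ Set.Ioo α β)
      (β - α) := by
  intro η hη
  obtain ⟨c, hc, hN⟩ := tendsto_ncard_primitiveVectors_div_sq L
  set θ : ℝ := min (η / 4) (1 / 2) with hθ
  have hθ0 : 0 < θ := lt_min (by linarith) (by norm_num)
  have hθη : θ ≤ η / 4 := min_le_left _ _
  have hθ1 : θ ≤ 1 / 2 := min_le_right _ _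
  -- Gives k/(k+1) > 1 - θ, so each arc receives at least the fraction 1 - θ of its expected share.
  obtain ⟨k, hk⟩ := exists_nat_gt (1 / θ)
  have hk0 : (0 : ℝ) < k := lt_trans (by positivity) hk
  obtain ⟨F, hF, hdisj, hsum⟩ := exists_finset_disjoint_arcs (α := α) (β := β) (k := k)
    (by exact_mod_cast hk0) hθ0
  have harc : ∀ r ∈ F, ∀ᶠ T : ℝ in atTop,
      c * (1 - θ) * (1 / (k * (r.den : ℝ) ^ 2)) * T ^ 2 ≤
        (vectorsWithRatioIn L (Set.Ioo (r : ℝ) (r + 1 / (k * (r.den : ℝ) ^ 2))) T).ncard := by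
    intro r _
    have hd : (0 : ℝ) < r.den := by exact_mod_cast r.den_pos
    have h2 := eventually_mul_sq_le_ncard_vectorsWithRatioIn L hc hN (p := r.num) (q := r.den)
      (by exact_mod_cast r.den_pos)
      (Int.isCoprime_iff_gcd_eq_one.2 (by simpa [Int.gcd, Int.natAbs_natCast] using r.reduced))
      (k := k) (by exact_mod_cast hk0)
      (a := c * (1 - θ) * (1 / (k * (r.den : ℝ) ^ 2))) (by
        rw [mul_assoc]
        refine mul_lt_mul_of_pos_left ?_ hc
        rw [mul_one_div, div_lt_div_iff₀ (by positivity) (by push_cast; positivity)]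
        rw [div_lt_iff₀ hθ0] at hk
        push_cast
        have : (1 - θ) * (k + 1) < k := by nlinarith
        nlinarith [sq_pos_of_pos hd])
    have h3 : ((r.num : ℤ) : ℝ) / ((r.den : ℤ) : ℝ) = r := by
      exact_mod_cast congrArg (fun x : ℚ => (x : ℝ)) (Rat.num_div_den r)
    rw [h3] at h2
    simpa using h2
  have hN2 : ∀ᶠ T : ℝ in atTop,
      (β - α - η) * (((primitiveVectors L T).ncard : ℝ) / T ^ 2) < c * (1 - θ) * (β - α - θ) := by
    refine (hN.const_mul (β - α - η)).eventually_lt_const ?_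
    -- Since β - α ≤ 1, the loss from both factors is at most 2θ, less than η.
    nlinarith [mul_pos hc hθ0]
  filter_upwards [(Finset.eventually_all F).2 harc, hN2, eventually_gt_atTop 0] with T hT hT2 hT0
  rw [mul_div_assoc', div_lt_iff₀ (by positivity)] at hT2
  have hle : ∑ r ∈ F,
      (vectorsWithRatioIn L (Set.Ioo (r : ℝ) (r + 1 / (k * (r.den : ℝ) ^ 2))) T).ncard ≤
      {v ∈ primitiveVectors L T |
        ∃ w, IsPositiveBasis L v w ∧ (w / v).re ∈ Set.Ioo α β}.ncard := by
    refine sum_ncard_le_ncard F _ ((finite_primitiveVectors L T).subset fun v hv => hv.1) ?_ ?_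
    · rintro r hr v ⟨hv, w, hw, hm⟩
      exact ⟨hv, w, hw, hF r hr (Set.Ioo_subset_Icc_self hm)⟩
    · rintro r hr r' hr' v ⟨-, w, hw, hm⟩ ⟨-, w', hw', hm'⟩
      have hm1 := Set.Ioo_subset_Icc_self hm
      have hm2 := Set.Ioo_subset_Icc_self hm'
      rw [hw.eq_of_re_div_mem_Ioo hw' h1 (hF r hr hm1) (hF r' hr' hm2)] at hm2
      by_contra hne
      exact Set.disjoint_left.1 (hdisj hr hr' hne) hm1 hm2
  calc (β - α - η) * ((primitiveVectors L T).ncard : ℝ)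
      ≤ c * (1 - θ) * (β - α - θ) * T ^ 2 := hT2.le
    _ ≤ c * (1 - θ) * (∑ r ∈ F, 1 / (k * (r.den : ℝ) ^ 2)) * T ^ 2 := by
        have : 0 ≤ 1 - θ := by linarith
        gcongr
    _ = ∑ r ∈ F, c * (1 - θ) * (1 / (k * (r.den : ℝ) ^ 2)) * T ^ 2 := by
        rw [Finset.mul_sum, Finset.sum_mul]
    _ ≤ ∑ r ∈ F, ((vectorsWithRatioIn L
          (Set.Ioo (r : ℝ) (r + 1 / (k * (r.den : ℝ) ^ 2))) T).ncard : ℝ) :=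
        Finset.sum_le_sum hT
    _ ≤ _ := by exact_mod_cast hle

section LowerDensity

variable {L : Submodule ℤ ℂ} [DiscreteTopology L]

lemma HasLowerDensity.mono {P Q : ℂ → Prop} {ℓ : ℝ} (h : HasLowerDensity L P ℓ)
    (hPQ : ∀ v, IsPrimitiveVector L v → P v → Q v) : HasLowerDensity L Q ℓ := by
  intro η hη
  filter_upwards [h η hη] with T hT
  refine hT.trans ?_
  rw [Nat.cast_le]
  exact Set.ncard_le_ncard (fun v hv => ⟨hv.1, hPQ v hv.1.1 hv.2⟩)
    ((finite_primitiveVectors L T).subset fun v hv => hv.1)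

lemma HasLowerDensity.or {P Q : ℂ → Prop} {ℓ m : ℝ} (hP : HasLowerDensity L P ℓ)
    (hQ : HasLowerDensity L Q m) (hPQ : ∀ v, P v → ¬ Q v) :
    HasLowerDensity L (fun v => P v ∨ Q v) (ℓ + m) := by
  intro η hη
  filter_upwards [hP (η / 2) (by linarith), hQ (η / 2) (by linarith)] with T h1 h2
  have hfin := finite_primitiveVectors L T
  have h3 : {v ∈ primitiveVectors L T | P v ∨ Q v} =
      {v ∈ primitiveVectors L T | P v} ∪ {v ∈ primitiveVectors L T | Q v} := by
    ext v
    exact and_or_left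
  rw [h3, Set.ncard_union_eq (Set.disjoint_left.2 fun v h h' => hPQ v h.2 h'.2)
    (hfin.subset fun v hv => hv.1) (hfin.subset fun v hv => hv.1)]
  push_cast
  linarith

lemma tendsto_ncard_primitiveVectors_atTop (L : Submodule ℤ ℂ) [DiscreteTopology L]
    [IsZLattice ℝ L] :
    Tendsto (fun T : ℝ => ((primitiveVectors L T).ncard : ℝ)) atTop atTop := by
  obtain ⟨c, hc, h⟩ := tendsto_ncard_primitiveVectors_div_sq L
  have h2 := h.pos_mul_atTop hc (tendsto_pow_atTop (α := ℝ) two_ne_zero)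
  refine h2.congr' ?_
  filter_upwards [eventually_gt_atTop 0] with T hT
  field_simp

/-- The lower bound for `Q` is an upper bound for `P`, as the two are disjoint and the densities add
up to one. -/
lemma HasLowerDensity.tendsto [IsZLattice ℝ L] {P Q : ℂ → Prop} {ℓ m : ℝ}
    (hP : HasLowerDensity L P ℓ) (hQ : HasLowerDensity L Q m) (hPQ : ∀ v, P v → ¬ Q v)
    (hsum : ℓ + m = 1) :
    Tendsto (fun T : ℝ => ({v ∈ primitiveVectors L T | P v}.ncard : ℝ) /
      ((primitiveVectors L T).ncard : ℝ)) atTop (𝓝 ℓ) := by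
  rw [Metric.tendsto_nhds]
  intro ε hε
  filter_upwards [hP (ε / 2) (by linarith), hQ (ε / 2) (by linarith),
    (tendsto_ncard_primitiveVectors_atTop L).eventually_gt_atTop 0] with T h1 h2 h0
  have hfin := finite_primitiveVectors L T
  have h3 : {v ∈ primitiveVectors L T | P v}.ncard + {v ∈ primitiveVectors L T | Q v}.ncard ≤
      (primitiveVectors L T).ncard := by
    rw [← Set.ncard_union_eq (Set.disjoint_left.2 fun v h h' => hPQ v h.2 h'.2)
      (hfin.subset fun v hv => hv.1) (hfin.subset fun v hv => hv.1)]
    exact Set.ncard_le_ncard (Set.union_subset (fun v hv => hv.1) (fun v hv => hv.1)) hfin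
  have h4 : ({v ∈ primitiveVectors L T | P v}.ncard : ℝ) +
      {v ∈ primitiveVectors L T | Q v}.ncard ≤ (primitiveVectors L T).ncard := by
    exact_mod_cast h3
  have hm : m = 1 - ℓ := by linarith
  subst hm
  rw [Real.dist_eq, abs_lt, lt_sub_iff_add_lt, sub_lt_iff_lt_add, lt_div_iff₀ h0, div_lt_iff₀ h0]
  have := mul_pos hε h0
  constructor <;> linarith

end LowerDensity

/-! ### From the real part to the signed ratio -/

/-- For z = w/v the angle is acute exactly when Re z > 0, so the difference is ±(|z| - |Re z|). -/
lemma abs_signedRatio_sub_re_div_le {v w : ℂ} (hv : v ≠ 0) (him : 0 < (w / v).im) :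
    |signedRatio v w - (w / v).re| ≤ (w / v).im := by
  have hw : w ≠ 0 := by rintro rfl; simp at him
  have hnorm : ‖w‖ / ‖v‖ = ‖w / v‖ := (norm_div _ _).symm
  have h1 := Complex.norm_le_abs_re_add_abs_im (w / v)
  have h2 := Complex.abs_re_le_norm (w / v)
  rw [abs_of_pos him] at h1
  have hinner : inner ℝ v w = ‖v‖ ^ 2 * (w / v).re := by
    have hns : Complex.normSq v ≠ 0 := by simpa using hv
    rw [Complex.inner, Complex.sq_norm, Complex.div_re]
    field_simp
    simp
  have hangle : InnerProductGeometry.angle v w < Real.pi / 2 ↔ 0 < (w / v).re := by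
    have hvw : 0 < ‖v‖ * ‖w‖ := mul_pos (norm_pos_iff.2 hv) (norm_pos_iff.2 hw)
    have hv2 : 0 < ‖v‖ ^ 2 := pow_pos (norm_pos_iff.2 hv) 2
    rw [InnerProductGeometry.angle, Real.arccos_lt_pi_div_two, hinner,
      div_pos_iff_of_pos_right hvw, mul_pos_iff_of_pos_left hv2]
  rw [signedRatio, hnorm]
  split_ifs with h
  · rw [hangle] at h
    rw [abs_of_pos h] at h1 h2
    rw [abs_le]; constructor <;> linarith
  · rw [hangle, not_lt] at h
    rw [abs_of_nonpos h] at h1 h2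
    rw [abs_le]; constructor <;> linarith

section SignedRatio

variable {L : Submodule ℤ ℂ} [DiscreteTopology L] [IsZLattice ℝ L] {ρ : ℂ → ℝ}

lemma hasLowerDensity_signedRatio_mem_Ioo
    (hρ : ∀ v, IsPrimitiveVector L v → IsSignedRatio L v (ρ v)) {α β : ℝ}
    (hα : -(1 / 2) ≤ α) (hβ : β ≤ 1 / 2) :
    HasLowerDensity L (fun v => α < ρ v ∧ ρ v < β) (β - α) := by
  intro η hη
  obtain ⟨e₁, e₂, he⟩ := exists_isPositiveBasis L
  set A := cross e₁ e₂ with hA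
  have hA0 : 0 < A := he.cross_pos
  -- Shrinking the interval at both ends costs η/4, the density estimate another η/4, and the
  -- finitely many `v` of norm at most `R` the remaining η/2.
  set δ := η / 8 with hδ
  have hδ0 : 0 < δ := by positivity
  -- Beyond this norm, Im(v'/v) = A/|v|² is less than δ.
  set R := Real.sqrt (A / δ) with hR
  have hRfin := finite_primitiveVectors L R
  filter_upwards [hasLowerDensity_of_re_div_mem_Ioo L (α := α + δ) (β := β - δ) (by linarith)
      (η / 4) (by linarith),
    (tendsto_ncard_primitiveVectors_atTop L).eventually_ge_atTop
      ((primitiveVectors L R).ncard / (η / 2))] with T h1 h2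
  rw [div_le_iff₀ (by positivity)] at h2
  have hfin := finite_primitiveVectors L T
  have hsub : {v ∈ primitiveVectors L T |
      ∃ w, IsPositiveBasis L v w ∧ (w / v).re ∈ Set.Ioo (α + δ) (β - δ)} ⊆
      {v ∈ primitiveVectors L T | α < ρ v ∧ ρ v < β} ∪ primitiveVectors L R := by
    rintro v ⟨hv, w, hw, hmem⟩
    rcases le_or_gt ‖v‖ R with hvR | hvR
    · exact Or.inr ⟨hv.1, hvR⟩
    refine Or.inl ⟨hv, ?_⟩
    have hv0 : v ≠ 0 := ne_zero_of_cross_pos hw.cross_pos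
    obtain ⟨v', hv', hρv⟩ := hρ v hv.1
    have habs := abs_le.1 hv'.abs_re_div_le
    -- The real parts differ by an integer; one lies within [-1/2, 1/2] and the other strictly
    -- inside, so that integer is zero.
    have hv'w : v' = w := by
      obtain ⟨n, rfl⟩ := hw.exists_eq_add_zsmul hv'.1
      have h3 : (w + n • v) / v = w / v + n := by rw [zsmul_eq_mul]; field_simp
      rw [h3, Complex.add_re, Complex.intCast_re] at habs
      have h4 : (n : ℝ) < 1 := by linarith [hmem.1]
      have h5 : (-1 : ℝ) < n := by linarith [hmem.2]
      have h6 : n < 1 := by exact_mod_cast h4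
      have h7 : -1 < n := by exact_mod_cast h5
      have h8 : n = 0 := by omega
      simp [h8]
    subst hv'w
    have h3 := abs_signedRatio_sub_re_div_le hv0 hw.2.2
    rw [← hρv] at h3
    have h4 : (v' / v).im < δ := by
      have hvpos : 0 < ‖v‖ := norm_pos_iff.2 hv0
      rw [im_div_eq_cross, (he.iff_cross_eq.1 hw).2.2, div_lt_iff₀ (by positivity), ← hA]
      have h5 := Real.lt_sq_of_sqrt_lt hvR
      rw [div_lt_iff₀ hδ0] at h5
      linarith
    rw [abs_le] at h3
    constructor <;> linarith [hmem.1, hmem.2]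
  have hle : ({v ∈ primitiveVectors L T |
      ∃ w, IsPositiveBasis L v w ∧ (w / v).re ∈ Set.Ioo (α + δ) (β - δ)}.ncard : ℝ) ≤
      {v ∈ primitiveVectors L T | α < ρ v ∧ ρ v < β}.ncard + (primitiveVectors L R).ncard := by
    have h3 := Set.ncard_le_ncard hsub ((hfin.subset fun v hv => hv.1).union hRfin)
    have h4 := Set.ncard_union_le {v ∈ primitiveVectors L T | α < ρ v ∧ ρ v < β}
      (primitiveVectors L R)
    exact_mod_cast h3.trans h4
  have h3 : (β - δ - (α + δ) - η / 4) * ((primitiveVectors L T).ncard : ℝ) =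
    (β - α - η) * (primitiveVectors L T).ncard + (primitiveVectors L T).ncard * (η / 2) := by
    rw [hδ]; ring
  linarith

lemma hasLowerDensity_fract_signedRatio_mem_Ioo
    (hρ : ∀ v, IsPrimitiveVector L v → IsSignedRatio L v (ρ v)) {a b : ℝ}
    (ha : 0 ≤ a) (hb : b ≤ 1) :
    HasLowerDensity L (fun v => a < Int.fract (ρ v) ∧ Int.fract (ρ v) < b) (b - a) := by
  -- The interval (a, b) is cut at 1/2 and the upper piece is shifted by -1 into [-1/2, 0]; a
  -- missing piece appears as an empty interval of length zero.
  have h1 := hasLowerDensity_signedRatio_mem_Ioo hρ (α := min a (1 / 2)) (β := min b (1 / 2))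
    (le_min (by linarith) (by norm_num)) (min_le_right _ _)
  have h2 := hasLowerDensity_signedRatio_mem_Ioo hρ (α := max a (1 / 2) - 1)
    (β := max b (1 / 2) - 1) (by linarith [le_max_right a (1 / 2)])
    (by linarith [max_le hb (by norm_num : (1 / 2 : ℝ) ≤ 1)])
  have hpos : ∀ x, min a (1 / 2) < x → x < min b (1 / 2) → 0 < x := fun x hx _ =>
    lt_of_le_of_lt (le_min ha (by norm_num)) hx
  have hneg : ∀ x, max a (1 / 2) - 1 < x → x < max b (1 / 2) - 1 → x < 0 := fun x _ hx => by
    linarith [max_le hb (by norm_num : (1 / 2 : ℝ) ≤ 1)]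
  have h3 := h1.or h2 fun v h h' =>
    absurd (hpos _ h.1 h.2) (not_lt.2 (hneg _ h'.1 h'.2).le)
  have hlen : min b (1 / 2) - min a (1 / 2) + (max b (1 / 2) - 1 - (max a (1 / 2) - 1)) =
      b - a := by
    linarith [min_add_max a (1 / 2), min_add_max b (1 / 2)]
  rw [hlen] at h3
  refine h3.mono fun v _ hv => ?_
  rcases hv with ⟨h4, h5⟩ | ⟨h4, h5⟩
  · have h6 := hpos _ h4 h5
    rw [lt_min_iff] at h5
    have h7 : Int.fract (ρ v) = ρ v := Int.fract_eq_self.2 ⟨h6.le, by linarith⟩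
    rw [h7]
    refine ⟨?_, h5.1⟩
    rcases min_lt_iff.1 h4 with h8 | h8 <;> linarith
  · have h6 := hneg _ h4 h5
    have h8 := le_max_left a (1 / 2)
    have h9 := le_max_right a (1 / 2)
    have h7 : Int.fract (ρ v) = ρ v + 1 := by
      rw [← Int.fract_add_one, Int.fract_eq_self]
      constructor <;> linarith
    rw [h7]
    refine ⟨by linarith, ?_⟩
    rcases lt_max_iff.1 (lt_sub_iff_add_lt.1 h5) with h10 | h10 <;> linarith

end SignedRatio

theorem theorem1 (L : Submodule ℤ ℂ) [DiscreteTopology L] [IsZLattice ℝ L] :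
    (∀ v, IsPrimitiveVector L v → ∃ r, IsSignedRatio L v r) ∧
    ∀ ρ : ℂ → ℝ, (∀ v, IsPrimitiveVector L v → IsSignedRatio L v (ρ v)) →
      UniformlyDistributedModOne (primitiveVectors L) ρ ∧
      ∀ α β : ℝ, -(1 / 2) < α → α ≤ β → β ≤ 1 / 2 →
        Tendsto (fun T : ℝ =>
            ({v ∈ primitiveVectors L T | α < ρ v ∧ ρ v < β}.ncard : ℝ) /
              ((primitiveVectors L T).ncard : ℝ))
          atTop (𝓝 (β - α)) := by
  refine ⟨fun v hv => ?_, fun ρ hρ => ⟨⟨finite_primitiveVectors L, fun a b ha hab hb => ?_⟩,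
    fun α β hα hαβ hβ => ?_⟩⟩
  · obtain ⟨w, hw⟩ := exists_isMinimalCompletion hv
    exact ⟨_, w, hw, rfl⟩
  · have h := (hasLowerDensity_fract_signedRatio_mem_Ioo hρ ha hb).mono
      (Q := fun v => Int.fract (ρ v) ∈ Set.Ico a b) fun v _ hv => ⟨hv.1.le, hv.2⟩
    -- The complementary intervals (0, a) and (b, 1) bring the total length to one, so endpoints
    -- carry no density.
    have h1 := hasLowerDensity_fract_signedRatio_mem_Ioo hρ le_rfl (hab.le.trans hb)
    have h2 := hasLowerDensity_fract_signedRatio_mem_Ioo hρ (ha.trans hab.le) le_rfl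
    refine h.tendsto (h1.or h2 fun v hv hv' => ?_) (fun v hv hv' => ?_) (by ring)
    · linarith [hv.2, hv'.1]
    · rcases hv' with hv' | hv'
      · linarith [hv.1, hv'.2]
      · linarith [hv.2, hv'.1]
  · have h := hasLowerDensity_signedRatio_mem_Ioo hρ hα.le hβ
    have h1 := hasLowerDensity_signedRatio_mem_Ioo hρ le_rfl (hαβ.trans hβ)
    have h2 := hasLowerDensity_signedRatio_mem_Ioo hρ (hα.le.trans hαβ) le_rfl
    refine h.tendsto (h1.or h2 fun v hv hv' => ?_) (fun v hv hv' => ?_) (by ring)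
    · linarith [hv.2, hv'.1]
    · rcases hv' with hv' | hv'
      · linarith [hv.1, hv'.2]
      · linarith [hv.2, hv'.1]
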